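/- Let $p > 10$ be a prime. Let $X^*(p)$ be the set of $x = (x_1,x_2,x_3) \in (\mathbb{Z}/p\mathbb{Z})^3 \setminus \{(0,0,0)\}$ with $x_1^2+x_2^2+x_3^2-3x_1x_2x_3=0$. For $j \in \{1,2,3\}$ and $\xi \in \mathbb{Z}/p\mathbb{Z}$ let $C_j(\xi) = \{x \in X^*(p) : x_j = \xi\}$. The incidence graph $I(p)$ is the multigraph whose vertices are the conic sections $C_j(\xi)$ for which $\xi$ is the $j$-th coordinate of some triple in $X^*(p)$ (that is, the nonempty $C_j(\xi)$), two distinct conic sections $C_j(\xi)$ and $C_k(\eta)$ being joined by exactly $|C_j(\xi)\cap C_k(\eta)|$ edges. Then $I(p)$ is connected, and its diameter is exactly $2$. -/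

import Mathlib

namespace Markoff

/-- The nonzero Markoff triples modulo `p`: the solutions of
`x₁² + x₂² + x₃² - 3 x₁ x₂ x₃ = 0` over `ℤ/pℤ` other than `(0, 0, 0)`.
The coordinates are indexed by `0, 1, 2`. -/
def triples (p : ℕ) : Set (Fin 3 → ZMod p) :=
  {x | x 0 ^ 2 + x 1 ^ 2 + x 2 ^ 2 - 3 * x 0 * x 1 * x 2 = 0 ∧ x ≠ 0}

/-- The conic section `C_j(a)`: the nonzero Markoff triples whose `j`-th coordinate is `a`. -/
def conic (p : ℕ) (j : Fin 3) (a : ZMod p) : Set (Fin 3 → ZMod p) :=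
  {x | x ∈ triples p ∧ x j = a}

/-- The conic sections `C_j(ξ)` in which `ξ` occurs as `j`-th coordinate of a nonzero Markoff
triple. -/
def conics (p : ℕ) : Set (Set (Fin 3 → ZMod p)) :=
  {C | ∃ x ∈ triples p, ∃ j : Fin 3, C = conic p j (x j)}

/-- The incidence graph `I(p)`, a multigraph. Its vertices are the conic sections; distinct conic
sections `C` and `D` are joined by one edge for every point `z` of `C ∩ D`. The edge is the
unordered pair `{C, D}` together with the point `z`. -/
def incidenceGraph (p : ℕ) :
    Graph (Set (Fin 3 → ZMod p)) (Sym2 (Set (Fin 3 → ZMod p)) × (Fin 3 → ZMod p)) where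
  vertexSet := conics p
  IsLink e C D :=
    C ∈ conics p ∧ D ∈ conics p ∧ C ≠ D ∧ e.1 = s(C, D) ∧ e.2 ∈ C ∩ D
  isLink_symm := by
    rintro e -
    exact ⟨fun C D ⟨hC, hD, hne, he, hz⟩ =>
      ⟨hD, hC, hne.symm, he.trans Sym2.eq_swap, hz.2, hz.1⟩⟩
  eq_or_eq_of_isLink_of_isLink := by
    rintro e C D C' D' ⟨-, -, -, he, -⟩ ⟨-, -, -, he', -⟩
    rcases Sym2.eq_iff.1 (he.symm.trans he') with h | h
    · exact Or.inl h.1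
    · exact Or.inr h.1
  left_mem_of_isLink := fun _ _ _ h => h.1

/-- The number of edges between two distinct conic sections is the number of their common
points. -/
theorem ncard_edges (p : ℕ) {C D : Set (Fin 3 → ZMod p)} (hC : C ∈ conics p) (hD : D ∈ conics p)
    (hne : C ≠ D) : {e | (incidenceGraph p).IsLink e C D}.ncard = (C ∩ D).ncard := by
  have h : {e | (incidenceGraph p).IsLink e C D} = Prod.mk s(C, D) '' (C ∩ D) := by
    ext ⟨e, z⟩
    constructor
    · rintro ⟨-, -, -, he, hz⟩
      exact ⟨z, hz, Prod.ext he.symm rfl⟩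
    · rintro ⟨w, hw, heq⟩
      obtain ⟨rfl, rfl⟩ := Prod.mk.inj heq
      exact ⟨hC, hD, hne, rfl, hw⟩
  rw [h, Set.ncard_image_of_injective _ (Prod.mk_right_injective _)]

end Markoff

/-! For `l ≠ j`, the conics `C_j(a)` and `C_l(c)` meet iff some triple contains both `a` and `c`;
for `a ≠ 0` this says that the discriminant `(9a² - 4)c² - 4a²` is a square. Since any two indices
avoid a third, the upper bound reduces to finding one `c` that serves two given values `a` and `b`
(`exists_common_coordinate`).

Detecting squares with the quadratic character `χ`, the weighted count of such `c` is `p`, up to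
three terms of size at most 1 and a sum `T` of `χ` over a cubic with distinct roots. Hasse's bound
is not needed: the squared sums over all Legendre cubics add up to at most `p² - 1`, and the square
for a given parameter recurs at a second one. Hence `2T² ≤ p² - 1`, which suffices for `p ≥ 11`.
Degenerate `a`, `b` are treated directly. -/

namespace Markoff

/-! ### Quadratic character sums -/

section CharacterSums

open Finset

variable {F : Type*} [Field F] [Fintype F] [DecidableEq F]

theorem abs_quadraticChar_le_one (a : F) : |quadraticChar F a| ≤ 1 := by
  rcases eq_or_ne a 0 with rfl | ha
  · simp
  · rcases quadraticChar_dichotomy ha with h | h <;> simp [h]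

theorem sum_quadraticChar_mul_sub_one (hF : ringChar F ≠ 2) :
    ∑ t : F, quadraticChar F (t * (t - 1)) = -1 := by
  have hJ := jacobiSum_nontrivial_inv (quadraticChar_ne_one hF)
  rw [(quadraticChar_isQuadratic F).inv, jacobiSum] at hJ
  have h : ∀ t : F, quadraticChar F (t * (t - 1)) =
      quadraticChar F (-1) * (quadraticChar F t * quadraticChar F (1 - t)) := fun t => by
    rw [← map_mul, ← map_mul]
    congr 1
    ring
  simp_rw [h]
  rw [← mul_sum, hJ, mul_neg, ← sq, quadraticChar_sq_one (neg_ne_zero.2 one_ne_zero)]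

theorem sum_quadraticChar_linear (hF : ringChar F ≠ 2) {a : F} (ha : a ≠ 0) (b : F) :
    ∑ t : F, quadraticChar F (a * t - b) = 0 := by
  rw [← quadraticChar_sum_zero hF]
  exact ((Equiv.mulLeft₀ a ha).trans (Equiv.subRight b)).sum_comp (quadraticChar F)

/-- An affine substitution moves the two distinct roots to 0 and 1. -/
theorem sum_quadraticChar_linear_mul_linear (hF : ringChar F ≠ 2) {a b c d : F} (ha : a ≠ 0)
    (hb : b ≠ 0) (h : c * b ≠ d * a) :
    ∑ t : F, quadraticChar F ((a * t - c) * (b * t - d)) = -quadraticChar F (a * b) := by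
  set e : F := d / b - c / a with he
  have he0 : e ≠ 0 := by
    rw [he, sub_ne_zero, ne_eq, div_eq_div_iff hb ha]
    exact fun h' => h h'.symm
  rw [← ((Equiv.mulLeft₀ e he0).trans (Equiv.addLeft (c / a))).sum_comp]
  have key : ∀ u : F, quadraticChar F ((a * (c / a + e * u) - c) * (b * (c / a + e * u) - d)) =
      quadraticChar F (a * b) * quadraticChar F (u * (u - 1)) := fun u => by
    have : (a * (c / a + e * u) - c) * (b * (c / a + e * u) - d) =
        a * b * (u * (u - 1)) * e ^ 2 := by
      have h1 : a * (c / a + e * u) - c = a * e * u := by field_simp; ring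
      have h2 : b * (c / a + e * u) - d = b * e * (u - 1) := by rw [he]; field_simp; ring
      rw [h1, h2]
      ring
    rw [this, map_mul, quadraticChar_sq_one' he0, mul_one, map_mul]
  simp only [Equiv.trans_apply, Equiv.coe_addLeft, Equiv.mulLeft₀_apply, key]
  rw [← mul_sum, sum_quadraticChar_mul_sub_one hF, mul_neg_one]

theorem sum_comp_sq (hF : ringChar F ≠ 2) (h : F → ℤ) :
    ∑ c : F, h (c ^ 2) = ∑ t : F, h t * (quadraticChar F t + 1) := by
  rw [← sum_fiberwise univ (fun c : F => c ^ 2)]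
  refine sum_congr rfl fun t _ => ?_
  rw [sum_congr rfl fun c hc => by rw [(mem_filter.1 hc).2], sum_const, nsmul_eq_mul, mul_comm,
    ← quadraticChar_card_sqrts hF]
  congr 3
  ext
  simp

/-- The sum of the quadratic character over the Legendre cubic with parameter `l`. -/
def legendreSum (F : Type*) [Field F] [Fintype F] [DecidableEq F] (l : F) : ℤ :=
  ∑ t : F, quadraticChar F (t * (t - 1)) * quadraticChar F (t - l)

/-- Second moment: after opening the square, the sum over `l` is nearly orthogonal in `t` and `s`,
leaving `q ∑ w² - (∑ w)²`, where `q` is the order of `F`. -/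
theorem sum_legendreSum_sq_le (hF : ringChar F ≠ 2) :
    ∑ l : F, legendreSum F l ^ 2 ≤ (Fintype.card F : ℤ) ^ 2 - 1 := by
  set w : F → ℤ := fun t => quadraticChar F (t * (t - 1)) with hw
  have inner : ∀ t s : F, ∑ l : F, quadraticChar F (t - l) * quadraticChar F (s - l) =
      (if t = s then (Fintype.card F : ℤ) else 0) - 1 := fun t s => by
    split_ifs with h
    · subst h
      rw [← (Equiv.subLeft t).sum_comp]
      simp only [Equiv.subLeft_apply, sub_sub_cancel, ← sq]
      rw [← add_sum_erase _ _ (mem_univ (0 : F)), sum_congr rfl fun x hx =>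
        quadraticChar_sq_one (ne_of_mem_erase hx)]
      simp [card_erase_of_mem, Nat.cast_sub Fintype.card_pos]
    · have := sum_quadraticChar_linear_mul_linear hF (a := (-1 : F)) (b := -1) (c := -t)
        (d := -s) (neg_ne_zero.2 one_ne_zero) (neg_ne_zero.2 one_ne_zero) (by simpa using h)
      simp only [neg_mul_neg, one_mul, map_one] at this
      rw [zero_sub, ← this]
      refine sum_congr rfl fun l _ => ?_
      rw [← map_mul]
      congr 1
      ring
  have expand : ∑ l : F, legendreSum F l ^ 2 =
      ∑ t : F, ∑ s : F, w t * w s * ((if t = s then (Fintype.card F : ℤ) else 0) - 1) := by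
    simp_rw [← inner, mul_sum]
    simp_rw [sq, legendreSum, sum_mul_sum]
    rw [sum_comm]
    refine sum_congr rfl fun t _ => ?_
    rw [sum_comm]
    refine sum_congr rfl fun s _ => sum_congr rfl fun l _ => ?_
    ring
  have hsum : ∑ t, w t = -1 := sum_quadraticChar_mul_sub_one hF
  have hsq : ∑ t, w t * w t ≤ Fintype.card F := by
    calc ∑ t, w t * w t ≤ ∑ _t : F, (1 : ℤ) := sum_le_sum fun t _ => by
          rw [← abs_mul_abs_self]
          exact mul_le_one₀ (abs_quadraticChar_le_one _) (abs_nonneg _)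
            (abs_quadraticChar_le_one _)
      _ = _ := by simp
  have : ∑ l : F, legendreSum F l ^ 2 =
      (∑ t, w t * w t) * Fintype.card F - (∑ t, w t) * (∑ t, w t) := by
    rw [expand, sum_mul_sum, sum_mul, ← sum_sub_distrib]
    refine sum_congr rfl fun t _ => ?_
    simp_rw [mul_sub, mul_one, sum_sub_distrib, mul_ite, mul_zero]
    simp
  rw [this, hsum]
  nlinarith [Int.natCast_nonneg (Fintype.card F)]

theorem legendreSum_inv {l : F} (hl : l ≠ 0) : legendreSum F l⁻¹ ^ 2 = legendreSum F l ^ 2 := by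
  have h : legendreSum F l⁻¹ = quadraticChar F l * legendreSum F l := by
    rw [legendreSum, legendreSum, mul_sum,
      ← Equiv.sum_comp (Equiv.mulLeft₀ l⁻¹ (inv_ne_zero hl))]
    refine sum_congr rfl fun t _ => ?_
    simp only [Equiv.mulLeft₀_apply]
    have : l⁻¹ * t * (l⁻¹ * t - 1) * (l⁻¹ * t - l⁻¹) =
        l * (t * (t - 1) * (t - l)) * (l⁻¹ ^ 2) ^ 2 := by field_simp
    rw [← map_mul, this, map_mul, quadraticChar_sq_one' (pow_ne_zero _ (inv_ne_zero hl)),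
      mul_one, map_mul, map_mul _ (t * (t - 1))]
  rw [h, mul_pow, quadraticChar_sq_one hl, one_mul]

theorem legendreSum_one_sub (l : F) : legendreSum F (1 - l) ^ 2 = legendreSum F l ^ 2 := by
  have h : legendreSum F (1 - l) = quadraticChar F (-1) * legendreSum F l := by
    rw [legendreSum, legendreSum, mul_sum, ← (Equiv.subLeft (1 : F)).sum_comp]
    refine sum_congr rfl fun t _ => ?_
    simp only [Equiv.subLeft_apply]
    rw [← map_mul, ← map_mul, ← map_mul]
    congr 1
    ring
  rw [h, mul_pow, quadraticChar_sq_one (neg_ne_zero.2 one_ne_zero), one_mul]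

theorem two_mul_legendreSum_sq_le (hF : ringChar F ≠ 2) (hF3 : (3 : F) ≠ 0) {l : F}
    (h0 : l ≠ 0) (h1 : l ≠ 1) : 2 * legendreSum F l ^ 2 ≤ (Fintype.card F : ℤ) ^ 2 - 1 := by
  obtain ⟨m, hm, hml⟩ : ∃ m, m ≠ l ∧ legendreSum F m ^ 2 = legendreSum F l ^ 2 := by
    by_cases h : l⁻¹ = l
    · refine ⟨1 - l, fun h' => ?_, legendreSum_one_sub l⟩
      -- The only fixed point of inversion left is -1; its partner `1 - l = 2` differs from it as `3
      -- ≠ 0`.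
      have hl : l = -1 := by
        have : l * l = 1 := by rw [← mul_inv_cancel₀ h0, h]
        exact (mul_self_eq_one_iff.1 this).resolve_left h1
      subst hl
      apply hF3
      linear_combination h'
    · exact ⟨l⁻¹, h, legendreSum_inv h0⟩
  refine le_trans ?_ (sum_legendreSum_sq_le hF)
  calc 2 * legendreSum F l ^ 2 = ∑ x ∈ {m, l}, legendreSum F x ^ 2 := by
        rw [sum_pair hm, hml, two_mul]
    _ ≤ _ := sum_le_sum_of_subset_of_nonneg (subset_univ _) fun _ _ _ => sq_nonneg _

/-- Scaling by `c / a` sends the roots `0, c/a, d/b` to `0, 1, da/(cb)`; squaring removes the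
remaining sign. -/
theorem sum_quadraticChar_cubic_sq {a b c d : F} (ha : a ≠ 0) (hb : b ≠ 0) (hc : c ≠ 0) :
    (∑ t : F, quadraticChar F (t * ((a * t - c) * (b * t - d)))) ^ 2 =
      legendreSum F (d * a / (c * b)) ^ 2 := by
  have hca : c / a ≠ 0 := div_ne_zero hc ha
  have h : ∑ t : F, quadraticChar F (t * ((a * t - c) * (b * t - d))) =
      quadraticChar F (b * c) * legendreSum F (d * a / (c * b)) := by
    rw [legendreSum, mul_sum, ← Equiv.sum_comp (Equiv.mulLeft₀ (c / a) hca)]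
    refine sum_congr rfl fun t _ => ?_
    simp only [Equiv.mulLeft₀_apply]
    have : c / a * t * ((a * (c / a * t) - c) * (b * (c / a * t) - d)) =
        b * c * (t * (t - 1) * (t - d * a / (c * b))) * (c / a) ^ 2 := by
      field_simp
    rw [this, map_mul, quadraticChar_sq_one' hca, mul_one, map_mul, map_mul _ (t * (t - 1))]
  rw [h, mul_pow, quadraticChar_sq_one (mul_ne_zero hb hc), one_mul]

theorem exists_isSquare_and_isSquare (hF : ringChar F ≠ 2) (hF3 : (3 : F) ≠ 0)
    (hcard : 10 < Fintype.card F) {a b c d : F} (ha : a ≠ 0) (hb : b ≠ 0) (hc : c ≠ 0)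
    (hd : d ≠ 0) (h : c * b ≠ d * a) :
    ∃ x : F, IsSquare (a * x ^ 2 - c) ∧ IsSquare (b * x ^ 2 - d) := by
  set χ := quadraticChar F
  have lin : ∀ a c : F, a ≠ 0 → c ≠ 0 → ∑ x : F, χ (a * x ^ 2 - c) = -χ a := by
    intro a c ha hc
    rw [sum_comp_sq hF fun t => χ (a * t - c)]
    simp_rw [mul_add, mul_one, sum_add_distrib, χ, sum_quadraticChar_linear hF ha, ← map_mul]
    have := sum_quadraticChar_linear_mul_linear hF ha (one_ne_zero (α := F)) (c := c) (d := 0)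
      (by simpa using hc)
    simpa using this
  have quad : ∑ x : F, χ ((a * x ^ 2 - c) * (b * x ^ 2 - d)) =
      (∑ t : F, χ (t * ((a * t - c) * (b * t - d)))) - χ (a * b) := by
    rw [sum_comp_sq hF fun t => χ ((a * t - c) * (b * t - d))]
    simp_rw [mul_add, mul_one, sum_add_distrib]
    rw [sum_quadraticChar_linear_mul_linear hF ha hb h, sub_eq_add_neg]
    congr 1
    refine sum_congr rfl fun t _ => ?_
    rw [← map_mul, mul_comm]
  set T := ∑ t : F, χ (t * ((a * t - c) * (b * t - d)))
  have hT : 2 * T ^ 2 ≤ (Fintype.card F : ℤ) ^ 2 - 1 := by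
    rw [sum_quadraticChar_cubic_sq ha hb hc]
    refine two_mul_legendreSum_sq_le hF hF3 (div_ne_zero (mul_ne_zero hd ha) (mul_ne_zero hc hb))
      fun h1 => h ?_
    rw [div_eq_one_iff_eq (mul_ne_zero hc hb)] at h1
    exact h1.symm
  have htotal : ∑ x : F, (1 + χ (a * x ^ 2 - c)) * (1 + χ (b * x ^ 2 - d)) =
      Fintype.card F - χ a - χ b - χ (a * b) + T := by
    have : ∀ x : F, (1 + χ (a * x ^ 2 - c)) * (1 + χ (b * x ^ 2 - d)) =
        1 + χ (a * x ^ 2 - c) + χ (b * x ^ 2 - d) +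
          χ ((a * x ^ 2 - c) * (b * x ^ 2 - d)) := fun x => by rw [map_mul]; ring
    simp_rw [this, sum_add_distrib, quad, lin a c ha hc, lin b d hb hd]
    simp
    ring
  have hpos : 0 < ∑ x : F, (1 + χ (a * x ^ 2 - c)) * (1 + χ (b * x ^ 2 - d)) := by
    rw [htotal]
    have h1 := (abs_le.1 (abs_quadraticChar_le_one a)).2
    have h2 := (abs_le.1 (abs_quadraticChar_le_one b)).2
    have h3 := (abs_le.1 (abs_quadraticChar_le_one (a * b))).2
    have hq : (11 : ℤ) ≤ Fintype.card F := by exact_mod_cast hcard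
    -- With `q` the order of `F`, `q² - 1 < 2(q - 3)²` holds from `q = 11` on, but fails at `q =
    -- 10`.
    have : -((Fintype.card F : ℤ) - 3) < T := by
      refine (abs_lt.1 (abs_lt_of_sq_lt_sq ?_ (by linarith))).1
      nlinarith
    simp only [χ] at *
    linarith
  obtain ⟨x, -, hx⟩ := exists_lt_of_sum_lt (s := univ) (f := fun _ : F => (0 : ℤ))
    (by simpa using hpos)
  have nonsq : ∀ y : F, 1 + χ y ≠ 0 → IsSquare y := fun y hy => by
    by_contra hns
    rw [← quadraticChar_neg_one_iff_not_isSquare] at hns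
    exact hy (by simp [χ, hns])
  exact ⟨x, nonsq _ (left_ne_zero_of_mul hx.ne'), nonsq _ (right_ne_zero_of_mul hx.ne')⟩

end CharacterSums

/-! ### Markoff triples with prescribed coordinates -/

section Triples

variable {p : ℕ}

theorem vec_mem_triples {a b c : ZMod p} :
    ![a, b, c] ∈ triples p ↔
      a ^ 2 + b ^ 2 + c ^ 2 - 3 * a * b * c = 0 ∧ ¬(a = 0 ∧ b = 0 ∧ c = 0) := by
  simp [triples, funext_iff, Fin.forall_fin_succ]

theorem comp_perm_mem_triples {x : Fin 3 → ZMod p} (hx : x ∈ triples p)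
    (σ : Equiv.Perm (Fin 3)) : x ∘ σ ∈ triples p := by
  obtain ⟨h, h0⟩ := hx
  refine ⟨?_, fun h' => h0 ?_⟩
  · have hs := Equiv.sum_comp σ fun i => x i ^ 2
    have hm := Equiv.prod_comp σ x
    simp only [Fin.sum_univ_three, Fin.prod_univ_three] at hs hm
    simp only [Function.comp_apply]
    linear_combination h + hs - 3 * hm
  · funext i
    simpa using congrFun h' (σ.symm i)

theorem exists_mem_triples_apply_eq {a b c : ZMod p} (h : ![a, b, c] ∈ triples p)
    {j l : Fin 3} (hjl : j ≠ l) : ∃ x ∈ triples p, x j = a ∧ x l = b := by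
  obtain ⟨σ, h0, h1⟩ : ∃ σ : Equiv.Perm (Fin 3), σ j = 0 ∧ σ l = 1 := by
    revert j l
    decide
  exact ⟨_, comp_perm_mem_triples h σ, by simp [h0], by simp [h1]⟩

theorem exists_vec_mem_triples {x : Fin 3 → ZMod p} (hx : x ∈ triples p) (j : Fin 3) :
    ∃ b c, ![x j, b, c] ∈ triples p := by
  refine ⟨x (Equiv.swap 0 j 1), x (Equiv.swap 0 j 2), ?_⟩
  convert comp_perm_mem_triples hx (Equiv.swap 0 j) using 1
  funext i
  fin_cases i <;> simp

variable [Fact p.Prime]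

theorem exists_vec_mem_triples_of_isSquare (h2 : (2 : ZMod p) ≠ 0) {a c : ZMod p} (ha : a ≠ 0)
    (h : IsSquare ((9 * a ^ 2 - 4) * c ^ 2 - 4 * a ^ 2)) : ∃ z, ![a, c, z] ∈ triples p := by
  obtain ⟨u, hu⟩ := h
  refine ⟨(3 * a * c + u) / 2, vec_mem_triples.2 ⟨?_, fun h' => ha h'.1⟩⟩
  field_simp
  linear_combination -hu

/-- Any two values that occur as coordinates have a common neighbour. -/
theorem exists_common_coordinate (hp10 : 10 < p) {a b a₁ a₂ b₁ b₂ : ZMod p}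
    (hA : ![a, a₁, a₂] ∈ triples p) (hB : ![b, b₁, b₂] ∈ triples p) :
    ∃ c z w, ![a, c, z] ∈ triples p ∧ ![b, c, w] ∈ triples p := by
  have hcast : ∀ n : ℕ, 0 < n → n ≤ 10 → (n : ZMod p) ≠ 0 := fun n hn hn' h =>
    absurd (Nat.le_of_dvd hn ((ZMod.natCast_eq_zero_iff n p).1 h)) (by omega)
  have h2 : (2 : ZMod p) ≠ 0 := by exact_mod_cast hcast 2 (by norm_num) (by norm_num)
  have h3 : (3 : ZMod p) ≠ 0 := by exact_mod_cast hcast 3 (by norm_num) (by norm_num)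
  have h4 : (4 : ZMod p) ≠ 0 := by exact_mod_cast hcast 4 (by norm_num) (by norm_num)
  -- For such `a`, the given triple yields a square root of -1, and then every nonzero `c` is a
  -- neighbour of `a`; any nonzero neighbour of `b` will do.
  have special : ∀ {a b a₁ a₂ b₁ b₂ : ZMod p}, ![a, a₁, a₂] ∈ triples p →
      ![b, b₁, b₂] ∈ triples p → a = 0 ∨ 9 * a ^ 2 - 4 = 0 →
      ∃ c z w, ![a, c, z] ∈ triples p ∧ ![b, c, w] ∈ triples p := by
    intro a b a₁ a₂ b₁ b₂ hA hB h
    obtain ⟨b', b'', hb', hB'⟩ : ∃ b' b'', b' ≠ 0 ∧ ![b, b', b''] ∈ triples p := by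
      by_cases hb1 : b₁ = 0
      · rw [vec_mem_triples] at hB
        refine ⟨b₂, b₁, fun hb2 => hB.2 ⟨?_, hb1, hb2⟩, vec_mem_triples.2 ⟨?_, ?_⟩⟩
        · have := hB.1
          rw [hb1, hb2] at this
          simpa using this
        · linear_combination hB.1
        · tauto
      · exact ⟨b₁, b₂, hb1, hB⟩
    rw [vec_mem_triples] at hA
    obtain ⟨i, hi⟩ : ∃ i : ZMod p, i ^ 2 = -1 := by
      rcases h with rfl | h
      · have ha1 : a₁ ≠ 0 := fun h' => hA.2 ⟨rfl, h', by simpa [h'] using hA.1⟩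
        refine ⟨a₂ / a₁, ?_⟩
        field_simp
        linear_combination hA.1
      · have ha : a ≠ 0 := by
          rintro rfl
          exact h4 (by linear_combination -h)
        refine ⟨(a₂ - 3 * a / 2 * a₁) / a, ?_⟩
        field_simp
        linear_combination 4 * hA.1 + a₁ ^ 2 * h
    rcases h with rfl | h
    · exact ⟨b', i * b', b'', vec_mem_triples.2
        ⟨by linear_combination b' ^ 2 * hi, fun h' => hb' h'.2.1⟩, hB'⟩
    · have ha : a ≠ 0 := by
        rintro rfl
        exact h4 (by linear_combination -h)
      obtain ⟨z, hz⟩ := exists_vec_mem_triples_of_isSquare h2 ha (c := b')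
        ⟨2 * a * i, by linear_combination b' ^ 2 * h - 4 * a ^ 2 * hi⟩
      exact ⟨b', z, b'', hz, hB'⟩
  by_cases hsa : a = 0 ∨ 9 * a ^ 2 - 4 = 0
  · exact special hA hB hsa
  by_cases hsb : b = 0 ∨ 9 * b ^ 2 - 4 = 0
  · obtain ⟨c, z, w, hz, hw⟩ := special hB hA hsb
    exact ⟨c, w, z, hw, hz⟩
  push Not at hsa hsb
  by_cases hab : a ^ 2 = b ^ 2
  · rcases sq_eq_sq_iff_eq_or_eq_neg.1 hab with rfl | rfl
    · exact ⟨_, _, _, hA, hA⟩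
    · rw [vec_mem_triples] at hA
      exact ⟨a₁, a₂, -a₂, vec_mem_triples.2 hA,
        vec_mem_triples.2 ⟨by linear_combination hA.1, fun h' => hsb.1 h'.1⟩⟩
  · obtain ⟨c, hca, hcb⟩ := exists_isSquare_and_isSquare (F := ZMod p)
      (by rw [ZMod.ringChar_zmod_n]; omega) h3 (by rwa [ZMod.card]) hsa.2 hsb.2
      (mul_ne_zero h4 (pow_ne_zero 2 hsa.1)) (mul_ne_zero h4 (pow_ne_zero 2 hsb.1))
      -- Proportional discriminants would force `16a² = 16b²`.
      fun h => hab (by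
        refine mul_left_cancel₀ (mul_ne_zero h4 h4) ?_
        linear_combination -h)
    obtain ⟨z, hz⟩ := exists_vec_mem_triples_of_isSquare h2 hsa.1 hca
    obtain ⟨w, hw⟩ := exists_vec_mem_triples_of_isSquare h2 hsb.1 hcb
    exact ⟨c, z, w, hz, hw⟩

end Triples

/-! ### Distances in the incidence graph -/

section IncidenceGraph

variable {p : ℕ}

theorem conic_mem_conics {x : Fin 3 → ZMod p} (hx : x ∈ triples p) (j : Fin 3) :
    conic p j (x j) ∈ conics p :=
  ⟨x, hx, j, rfl⟩

theorem toSimpleGraph_incidenceGraph_adj {C D : (incidenceGraph p).vertexSet} :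
    (incidenceGraph p).toSimpleGraph.Adj C D ↔
      C ≠ D ∧ ((C : Set (Fin 3 → ZMod p)) ∩ D).Nonempty := by
  rw [Graph.toSimpleGraph_adj]
  constructor
  · rintro ⟨hne, e, -, -, -, -, hz⟩
    exact ⟨hne, _, hz⟩
  · rintro ⟨hne, z, hz⟩
    exact ⟨hne, (s(C.1, D.1), z), C.2, D.2, fun h => hne (Subtype.ext h), rfl, hz⟩

theorem edist_le_one_of_inter_nonempty {C D : (incidenceGraph p).vertexSet}
    (h : ((C : Set (Fin 3 → ZMod p)) ∩ D).Nonempty) :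
    (incidenceGraph p).toSimpleGraph.edist C D ≤ 1 := by
  rw [SimpleGraph.edist_le_one_iff_adj_or_eq, toSimpleGraph_incidenceGraph_adj]
  tauto

theorem edist_le_two [Fact p.Prime] (hp10 : 10 < p) (C D : (incidenceGraph p).vertexSet) :
    (incidenceGraph p).toSimpleGraph.edist C D ≤ 2 := by
  obtain ⟨_, x, hx, j, rfl⟩ := C
  obtain ⟨_, y, hy, k, rfl⟩ := D
  obtain ⟨l, hjl, hkl⟩ : ∃ l : Fin 3, j ≠ l ∧ k ≠ l := by
    revert j k
    decide
  obtain ⟨_, _, hA⟩ := exists_vec_mem_triples hx j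
  obtain ⟨_, _, hB⟩ := exists_vec_mem_triples hy k
  obtain ⟨c, z, w, hz, hw⟩ := exists_common_coordinate hp10 hA hB
  obtain ⟨u, hu, huj, hul⟩ := exists_mem_triples_apply_eq hz hjl
  obtain ⟨v, hv, hvk, hvl⟩ := exists_mem_triples_apply_eq hw hkl
  let E : (incidenceGraph p).vertexSet := ⟨conic p l (u l), conic_mem_conics hu l⟩
  refine (SimpleGraph.edist_triangle (v := E)).trans ?_
  rw [← one_add_one_eq_two]
  exact add_le_add (edist_le_one_of_inter_nonempty ⟨u, ⟨hu, huj⟩, hu, rfl⟩)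
    (edist_le_one_of_inter_nonempty ⟨v, ⟨hv, hvl.trans hul.symm⟩, hv, hvk⟩)

end IncidenceGraph

end Markoff

/-- For every prime `p > 10` the incidence graph `I(p)` is connected and has diameter `2`.
Walks and distances of the multigraph are those of its underlying simple graph. -/
theorem propositionp2 (p : ℕ) (hp : p.Prime) (hp10 : 10 < p) :
    (Markoff.incidenceGraph p).toSimpleGraph.Connected ∧
      (Markoff.incidenceGraph p).toSimpleGraph.ediam = 2 := by
  have : Fact p.Prime := ⟨hp⟩
  have h1 : ![1, 1, 1] ∈ Markoff.triples p :=
    Markoff.vec_mem_triples.2 ⟨by norm_num, fun h => one_ne_zero h.1⟩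
  have h2 : ![2, 1, 1] ∈ Markoff.triples p :=
    Markoff.vec_mem_triples.2 ⟨by norm_num, fun h => one_ne_zero h.2.1⟩
  -- Two values of the same coordinate give disjoint nonempty conics, hence distance at least 2.
  let C : (Markoff.incidenceGraph p).vertexSet := ⟨_, Markoff.conic_mem_conics h1 0⟩
  let D : (Markoff.incidenceGraph p).vertexSet := ⟨_, Markoff.conic_mem_conics h2 0⟩
  have hdisj : ¬((C : Set (Fin 3 → ZMod p)) ∩ D).Nonempty := by
    rintro ⟨x, ⟨-, hx1⟩, -, hx2⟩
    have h12 : (1 : ZMod p) = 2 := hx1.symm.trans hx2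
    exact one_ne_zero (α := ZMod p) (by linear_combination -h12)
  have hle : (Markoff.incidenceGraph p).toSimpleGraph.ediam ≤ 2 :=
    SimpleGraph.ediam_le_of_edist_le (Markoff.edist_le_two hp10)
  have : Nonempty (Markoff.incidenceGraph p).vertexSet := ⟨C⟩
  refine ⟨SimpleGraph.connected_of_ediam_ne_top (ne_top_of_le_ne_top (by decide) hle),
    hle.antisymm (le_trans ?_ (SimpleGraph.edist_le_ediam (u := C) (v := D)))⟩
  rw [← one_add_one_eq_two]
  refine Order.add_one_le_of_lt (not_le.1 fun h => ?_)
  rw [SimpleGraph.edist_le_one_iff_adj_or_eq, Markoff.toSimpleGraph_incidenceGraph_adj] at h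
  rcases h with h | h
  · exact hdisj h.2
  · exact hdisj (h ▸ ⟨_, ⟨h1, rfl⟩, h1, rfl⟩)
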